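/- Consider, in continuous time ($\mathbb{T}=\mathbb{R}^+$, $\mathcal{D}x=\dot x$) or in discrete time ($\mathbb{T}=\mathbb{N}$, $(\mathcal{D}x)(t)=x(t+1)$), the linear time-invariant system $\Sigma$ $$\mathcal{D}x(t)=A\,x(t)+B\,u(t),\qquad y(t)=C\,x(t)+D\,u(t),$$ with $x(t)\in\mathbb{R}^n$, $u(t)\in\mathbb{R}^m$, $y(t)\in\mathbb{R}^p$ and real matrices $A,B,C,D$. Let $\mathbb{C}_g$ be the open left half-plane (continuous time) or the open unit disc (discrete time). Let $P_\Sigma(z)=\begin{bmatrix}A-zI_n&B\\ C&D\end{bmatrix}$, and let $\mathcal{Z}$ be the set of invariant zeros of $\Sigma$, that is, of those $z\in\mathbb{C}$ with $\operatorname{rank}P_\Sigma(z)<\max_{s\in\mathbb{C}}\operatorname{rank}P_\Sigma(s)$. Let $\mathcal{V}^\star_g$ be the largest subspace $\mathcal{V}\subseteq\mathbb{R}^n$ for which there is a real matrix $F$ with $(A+BF)\mathcal{V}\subseteq\mathcal{V}\subseteq\ker(C+DF)$ and $\sigma(A+BF\,|\,\mathcal{V})\subset\mathbb{C}_g$. For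 $j\in\{1,\dots,p\}$ and $\mu\in\mathbb{R}$ let $$\mathcal{R}^\star_j(\mu)=\left\{v\in\mathbb{R}^n \;\middle|\; \exists\, w\in\mathbb{R}^m:\ \begin{bmatrix}A-\mu I_n&B\\ C_{(j)}&D_{(j)}\end{bmatrix}\begin{bmatrix}v\\ w\end{bmatrix}=0\right\},$$ where $C_{(j)},D_{(j)}$ are obtained from $C,D$ by deleting the $j$-th row. Assume that the columns of $\begin{bmatrix}B\\ D\end{bmatrix}$ and the rows of $[\,C\;\;D\,]$ are linearly independent; that $\Sigma$ is right invertible (its transfer function matrix $C(sI-A)^{-1}B+D$ has a right inverse over $\mathbb{R}(s)$) and stabilisable ($\sigma(A+BF)\subset\mathbb{C}_g$ for some real $F$); that $0\notin\mathcal{Z}$ in continuous time, or $1\notin\mathcal{Z}$ in discrete time; and that $\dim\mathcal{V}^\star_g=n-p$. Let $\lambda_1,\dots,\lambda_p$ be real numbers that are not invariant zeros of $\Sigma$, with $\lambda_i<0$ for all $i$ in continuous time, or $\lambda_i\in(0,1)$ for all $i$ in discrete time. Then the following are equivalent. (i) There is a matrix $F\in\mathbb{R}^{m\times n}$ such that $\sigma(A+BF)\subset\mathbb{C}_g$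 and such that, for every step reference $r\in\mathbb{R}^p$, every steady state $(x_{ss},u_{ss})$ with $Cx_{ss}+Du_{ss}=r$ and $Ax_{ss}+Bu_{ss}=0$ (continuous time) or $Ax_{ss}+Bu_{ss}=x_{ss}$ (discrete time), and every initial condition $x(0)$, the control law $u(t)=F(x(t)-x_{ss})+u_{ss}$ yields a tracking error $\epsilon(t)=y(t)-r$ whose components are $\epsilon_k(t)=\beta_k\,e^{\lambda_k t}$ (continuous time) or $\epsilon_k(t)=\beta_k\,\lambda_k^{\,t}$ (discrete time) for all $t\in\mathbb{T}$ and $k\in\{1,\dots,p\}$, with real coefficients $\beta_1,\dots,\beta_p$ that do not depend on $t$. (ii) For every $S\subseteq\{1,\dots,p\}$, $$\dim\Big(\mathcal{V}^\star_g+\sum_{j\in S}\mathcal{R}^\star_j(\lambda_j)\Big)\ \ge\ n-p+\operatorname{card}(S).$$ -/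

import Mathlib

open scoped Matrix

noncomputable section

/-- The two time sets: `ℝ⁺` (continuous time) and `ℕ` (discrete time). -/
inductive TimeDomain where
  | continuous
  | discrete

namespace TimeDomain

/-- The stability region `ℂ_g`: the open left half-plane in continuous time, the open unit disc in
discrete time. -/
def stableRegion : TimeDomain → Set ℂ
  | continuous => {z | z.re < 0}
  | discrete => {z | ‖z‖ < 1}

/-- The real modes that may be prescribed for the tracking error: `(-∞, 0)` in continuous time,
`(0, 1)` in discrete time. -/
def errorModes : TimeDomain → Set ℝ
  | continuous => Set.Iio 0
  | discrete => Set.Ioo 0 1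

/-- The frequency of constant signals: `0` in continuous time, `1` in discrete time. -/
def steadyFreq : TimeDomain → ℝ
  | continuous => 0
  | discrete => 1

end TimeDomain

/-- The spectrum (complex roots of the characteristic polynomial) of a real endomorphism. -/
def realEndSpectrum {V : Type*} [AddCommGroup V] [Module ℝ V] [FiniteDimensional ℝ V]
    (f : V →ₗ[ℝ] V) : Set ℂ :=
  f.charpoly.rootSet ℂ

/-- A quadruple `(A, B, C, D)` of real matrices with `n` states, `m` inputs and outputs indexed by
`κ`; it stands for the system `𝒟x = Ax + Bu`, `y = Cx + Du`. -/
structure LTISystem (n m : ℕ) (κ : Type) where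
  /-- the state matrix -/
  A : Matrix (Fin n) (Fin n) ℝ
  /-- the input matrix -/
  B : Matrix (Fin n) (Fin m) ℝ
  /-- the output matrix -/
  C : Matrix κ (Fin n) ℝ
  /-- the feedthrough matrix -/
  D : Matrix κ (Fin m) ℝ

namespace LTISystem

variable {n m : ℕ} {κ : Type}

/-- The Rosenbrock matrix `[A - zI, B; C, D]` at a point `z` of `𝕜` (used for `𝕜 = ℝ, ℂ`). -/
def rosenbrock (sys : LTISystem n m κ) (𝕜 : Type) [Field 𝕜] [Algebra ℝ 𝕜] (z : 𝕜) :
    Matrix (Fin n ⊕ κ) (Fin n ⊕ Fin m) 𝕜 :=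
  Matrix.fromBlocks
    (sys.A.map (algebraMap ℝ 𝕜) - z • (1 : Matrix (Fin n) (Fin n) 𝕜))
    (sys.B.map (algebraMap ℝ 𝕜))
    (sys.C.map (algebraMap ℝ 𝕜))
    (sys.D.map (algebraMap ℝ 𝕜))

/-- The normal rank of the Rosenbrock pencil: the maximum over `z ∈ ℂ` of its rank at `z`. The
ranks are bounded by `n + m`, so the supremum in `ℕ` is a maximum. -/
def normalRank (sys : LTISystem n m κ) : ℕ :=
  ⨆ z : ℂ, (sys.rosenbrock ℂ z).rank

/-- The set of invariant zeros: the points of `ℂ` where the Rosenbrock matrix loses rank. -/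
def invariantZeros (sys : LTISystem n m κ) : Set ℂ :=
  {z | (sys.rosenbrock ℂ z).rank < sys.normalRank}

/-- The transfer function matrix `C (sI - A)⁻¹ B + D` over the field `ℝ(s)`. -/
def transferMatrix (sys : LTISystem n m κ) : Matrix κ (Fin m) (RatFunc ℝ) :=
  sys.C.map (algebraMap ℝ (RatFunc ℝ)) *
      ((RatFunc.X : RatFunc ℝ) • (1 : Matrix (Fin n) (Fin n) (RatFunc ℝ)) -
        sys.A.map (algebraMap ℝ (RatFunc ℝ)))⁻¹ *
      sys.B.map (algebraMap ℝ (RatFunc ℝ)) +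
    sys.D.map (algebraMap ℝ (RatFunc ℝ))

/-- Right invertibility: the transfer function matrix has a right inverse over `ℝ(s)`. -/
def RightInvertible [DecidableEq κ] (sys : LTISystem n m κ) : Prop :=
  ∃ R : Matrix (Fin m) κ (RatFunc ℝ), sys.transferMatrix * R = 1

/-- The closed-loop state map `A + BF`. -/
def closedLoop (sys : LTISystem n m κ) (F : Matrix (Fin m) (Fin n) ℝ) :
    (Fin n → ℝ) →ₗ[ℝ] (Fin n → ℝ) :=
  Matrix.toLin' (sys.A + sys.B * F)

/-- `F` makes the closed loop asymptotically stable: `σ(A + BF) ⊆ ℂ_g`. -/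
def IsStabilising (sys : LTISystem n m κ) (T : TimeDomain) (F : Matrix (Fin m) (Fin n) ℝ) : Prop :=
  realEndSpectrum (sys.closedLoop F) ⊆ T.stableRegion

/-- The pair `(A, B)` is stabilisable. -/
def Stabilisable (sys : LTISystem n m κ) (T : TimeDomain) : Prop :=
  ∃ F : Matrix (Fin m) (Fin n) ℝ, sys.IsStabilising T F

/-- `V` is a stabilisability output-nulling subspace: there is a feedback `F` with
`(A + BF) V ⊆ V ⊆ ker (C + DF)` and `σ(A + BF | V) ⊆ ℂ_g`. -/
def IsStabOutputNulling (sys : LTISystem n m κ) (T : TimeDomain)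
    (V : Submodule ℝ (Fin n → ℝ)) : Prop :=
  ∃ (F : Matrix (Fin m) (Fin n) ℝ) (hV : ∀ v ∈ V, sys.closedLoop F v ∈ V),
    (∀ v ∈ V, (sys.C + sys.D * F) *ᵥ v = 0) ∧
      realEndSpectrum ((sys.closedLoop F).restrict hV) ⊆ T.stableRegion

/-- `𝒱*_g`, the largest stabilisability output-nulling subspace: the join of all of them. -/
def Vg (sys : LTISystem n m κ) (T : TimeDomain) : Submodule ℝ (Fin n → ℝ) :=
  sSup {V | sys.IsStabOutputNulling T V}

/-- `ℛ*(μ)`: the vectors `v ∈ ℝⁿ` such that `(v, w)` lies in the kernel of the Rosenbrock matrix at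
the real number `μ` for some `w ∈ ℝᵐ`. -/
def kernelStates (sys : LTISystem n m κ) (μ : ℝ) : Submodule ℝ (Fin n → ℝ) :=
  (LinearMap.ker (sys.rosenbrock ℝ μ).mulVecLin).map
    (LinearMap.funLeft ℝ ℝ (Sum.inl : Fin n → Fin n ⊕ Fin m))

/-- The system obtained by deleting the `j`-th output. -/
def deleteOutput (sys : LTISystem n m κ) (j : κ) : LTISystem n m {k : κ // k ≠ j} where
  A := sys.A
  B := sys.B
  C := sys.C.submatrix Subtype.val id
  D := sys.D.submatrix Subtype.val id

/-- `ℛ*_j(μ)`: the state part of the kernel of the Rosenbrock matrix with the `j`-th output row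
deleted. -/
def Rj (sys : LTISystem n m κ) (j : κ) (μ : ℝ) : Submodule ℝ (Fin n → ℝ) :=
  (sys.deleteOutput j).kernelStates μ

/-- `(xss, uss)` is a steady state with output `r`: `0 = A xss + B uss` in continuous time,
`xss = A xss + B uss` in discrete time, and `r = C xss + D uss`. -/
def IsSteadyState (sys : LTISystem n m κ) (T : TimeDomain) (r : κ → ℝ)
    (xss : Fin n → ℝ) (uss : Fin m → ℝ) : Prop :=
  T.steadyFreq • xss = sys.A *ᵥ xss + sys.B *ᵥ uss ∧ r = sys.C *ᵥ xss + sys.D *ᵥ uss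

/-- Under the control law `u(t) = F (x(t) - xss) + uss`, from every initial condition, the `k`-th
component of the tracking error `y - r` is `β k * exp (lam k * t)` in continuous time,
`β k * lam k ^ t` in discrete time, with real coefficients `β` depending on the trajectory.
The initial condition `x 0` is unrestricted, since all state trajectories are considered. -/
def HasSingleModeError (sys : LTISystem n m κ) (T : TimeDomain) (lam : κ → ℝ)
    (F : Matrix (Fin m) (Fin n) ℝ) (r : κ → ℝ) (xss : Fin n → ℝ) (uss : Fin m → ℝ) : Prop :=
  match T with
  | .continuous =>
      ∀ (x : ℝ → Fin n → ℝ) (u : ℝ → Fin m → ℝ),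
        (∀ t, 0 ≤ t → u t = F *ᵥ (x t - xss) + uss) →
        (∀ t, 0 ≤ t → HasDerivWithinAt x (sys.A *ᵥ x t + sys.B *ᵥ u t) (Set.Ici 0) t) →
        ∃ β : κ → ℝ, ∀ t, 0 ≤ t → ∀ k,
          (sys.C *ᵥ x t + sys.D *ᵥ u t - r) k = β k * Real.exp (lam k * t)
  | .discrete =>
      ∀ (x : ℕ → Fin n → ℝ) (u : ℕ → Fin m → ℝ),
        (∀ t, u t = F *ᵥ (x t - xss) + uss) →
        (∀ t, x (t + 1) = sys.A *ᵥ x t + sys.B *ᵥ u t) →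
        ∃ β : κ → ℝ, ∀ t k,
          (sys.C *ᵥ x t + sys.D *ᵥ u t - r) k = β k * lam k ^ t

/-- The single-mode tracking problem with prescribed modes `lam` is solvable: some stabilising
feedback yields a single-mode tracking error from all initial conditions, for all step references
`r` and all corresponding steady states. -/
def SingleModeSolvable (sys : LTISystem n m κ) (T : TimeDomain) (lam : κ → ℝ) : Prop :=
  ∃ F : Matrix (Fin m) (Fin n) ℝ,
    sys.IsStabilising T F ∧
      ∀ (r : κ → ℝ) (xss : Fin n → ℝ) (uss : Fin m → ℝ),
        sys.IsSteadyState T r xss uss → sys.HasSingleModeError T lam F r xss uss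

end LTISystem

end

/-! A feedback produces single-mode errors exactly when row `k` of `C + DF` is zero or a left
eigenvector of `A + BF` for `lam k` (`forall_hasSingleModeError_iff`). The dynamical statement thus
becomes linear algebra modulo `𝒱*_g`.

Given such an `F`, `ker (C + DF)` is invariant, stable and output-nulling, so it lies in `𝒱*_g`. It
has dimension at least `n - p`, so the two coincide and `C + DF` is onto. A vector with output `e_j`
is then an eigenvector for `lam j` modulo `𝒱*_g`. Since the Rosenbrock matrix at `lam j` is onto,
the defect can be removed by an output-nulling correction, and maximality of `𝒱*_g` forces the
correction to stay in `𝒱*_g`. So each `ℛ*_j(lam j)` contains a vector with output `e_j`. These are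
independent modulo `𝒱*_g`, which gives the dimension bounds.

Conversely, the bounds are Rado's condition for the images of the `ℛ*_j(lam j)` in the quotient by
`𝒱*_g`. A transversal `v_j` completes `𝒱*_g` to the whole space. Keeping a stabilising feedback on
`𝒱*_g` and sending `v_j` to its kernel input `w_j` makes each `v_j` an eigenvector whose output is a
multiple of `e_j`.

Both directions need `𝒱*_g`, a supremum, to be stabilisability output-nulling itself
(`isStabOutputNulling_Vg`). Stability is handled throughout by annihilating polynomials with stable
roots, which multiply along extensions. -/

/-! ### Spectra, annihilating polynomials and extension of linear maps -/

open Polynomial in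
/-- The spectrum of `f` lies in `Ω` iff `f` is annihilated by a nonzero polynomial with roots
in `Ω`. -/
lemma realEndSpectrum_subset_iff {V : Type*} [AddCommGroup V] [Module ℝ V] [FiniteDimensional ℝ V]
    (f : V →ₗ[ℝ] V) (Ω : Set ℂ) :
    realEndSpectrum f ⊆ Ω ↔ ∃ q : ℝ[X], q ≠ 0 ∧ q.rootSet ℂ ⊆ Ω ∧ aeval f q = 0 := by
  constructor
  · intro h
    exact ⟨f.charpoly, f.charpoly_monic.ne_zero, h, f.aeval_self_charpoly⟩
  · rintro ⟨q, hq0, hqΩ, hq⟩ z hz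
    apply hqΩ
    rw [realEndSpectrum, mem_rootSet] at hz
    rw [mem_rootSet]
    refine ⟨hq0, ?_⟩
    -- A root of the characteristic polynomial is an eigenvalue of the complexification; `q`
    -- annihilates the latter, so it vanishes at each eigenvalue.
    have hroot : (f.baseChange ℂ).charpoly.IsRoot z := by
      rw [LinearMap.charpoly_baseChange, IsRoot, eval_map_algebraMap]
      exact hz.2
    have hev := (Module.End.hasEigenvalue_iff_isRoot_charpoly (f.baseChange ℂ) z).2 hroot
    obtain ⟨x, hx⟩ := hev.exists_hasEigenvector
    have h1 := Module.End.aeval_apply_of_hasEigenvector (p := q.map (algebraMap ℝ ℂ)) hx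
    have h2 : aeval (f.baseChange ℂ) (q.map (algebraMap ℝ ℂ)) = 0 := by
      rw [aeval_map_algebraMap]
      have := aeval_algHom_apply (Module.End.baseChangeHom ℝ ℂ V) f q
      rw [hq, map_zero] at this
      exact this
    rw [h2, LinearMap.zero_apply, eq_comm, smul_eq_zero, eval_map_algebraMap] at h1
    exact h1.resolve_right hx.2

open Polynomial in
lemma aeval_restrict_apply {K V : Type*} [Field K] [AddCommGroup V] [Module K V]
    (f : V →ₗ[K] V) (W : Submodule K V) (hW : ∀ v ∈ W, f v ∈ W) (q : K[X]) (v : W) :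
    (aeval (f.restrict hW) q v : V) = aeval f q v := by
  induction q using Polynomial.induction_on' with
  | add p q hp hq => simp [hp, hq]
  | monomial k a =>
    have : ∀ u : W, (((f.restrict hW) ^ k) u : V) = (f ^ k) u := by
      induction k with
      | zero => simp
      | succ k ih => intro u; simp [pow_succ, ih]
    simp [aeval_monomial, this]

open Polynomial in
lemma aeval_apply_mem {K V : Type*} [Field K] [AddCommGroup V] [Module K V]
    (f : V →ₗ[K] V) (W : Submodule K V) (hW : ∀ v ∈ W, f v ∈ W) (q : K[X]) {v : V} (hv : v ∈ W) :
    aeval f q v ∈ W := by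
  rw [← aeval_restrict_apply f W hW q ⟨v, hv⟩]
  exact Subtype.mem _

-- Changing a feedback off an invariant subspace therefore preserves annihilating polynomials on it.
open Polynomial in
lemma aeval_apply_congr {K V : Type*} [Field K] [AddCommGroup V] [Module K V]
    (f g : V →ₗ[K] V) (W : Submodule K V) (hW : ∀ v ∈ W, f v ∈ W) (hfg : ∀ v ∈ W, g v = f v)
    (q : K[X]) {v : V} (hv : v ∈ W) : aeval g q v = aeval f q v := by
  have hW' : ∀ v ∈ W, g v ∈ W := fun v hv => hfg v hv ▸ hW v hv
  have : g.restrict hW' = f.restrict hW := by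
    ext u
    exact hfg u u.2
  rw [← aeval_restrict_apply f W hW q ⟨v, hv⟩, ← aeval_restrict_apply g W hW' q ⟨v, hv⟩, this]

/-- A linear map can be modified off a subspace `W` so as to take prescribed values on a family
which is linearly independent modulo `W`. -/
lemma exists_linearMap_extension {K E M ι : Type*} [Field K] [AddCommGroup E] [Module K E]
    [AddCommGroup M] [Module K M] (W : Submodule K E) (f : E →ₗ[K] M) (v : ι → E)
    (hv : LinearIndependent K (fun i => W.mkQ (v i))) (w : ι → M) :
    ∃ g : E →ₗ[K] M, (∀ x ∈ W, g x = f x) ∧ ∀ i, g (v i) = w i := by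
  -- The correction to `f` is defined on the quotient, so it vanishes on `W`.
  obtain ⟨h, hh⟩ : ∃ h : (E ⧸ W) →ₗ[K] M, ∀ i, h (W.mkQ (v i)) = w i - f (v i) := by
    obtain ⟨h, hh⟩ := LinearMap.exists_extend
      ((Module.Basis.span hv).constr K (fun i => w i - f (v i)))
    refine ⟨h, fun i => ?_⟩
    have h1 := LinearMap.congr_fun hh (Module.Basis.span hv i)
    rw [Module.Basis.constr_basis] at h1
    rwa [LinearMap.comp_apply, Submodule.subtype_apply, Module.Basis.span_apply] at h1
  refine ⟨f + h ∘ₗ W.mkQ, fun x hx => ?_, fun i => ?_⟩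
  · have : W.mkQ x = 0 := by simpa using hx
    simp only [LinearMap.add_apply, LinearMap.comp_apply, this, map_zero, add_zero]
  · simp only [LinearMap.add_apply, LinearMap.comp_apply, hh, add_sub_cancel]

/-! ### Rado's theorem for subspaces -/

/-- A subspace of dimension at least two is the join of two proper subspaces. -/
lemma exists_sup_eq_of_two_le_finrank {K E : Type*} [Field K] [AddCommGroup E] [Module K E]
    [FiniteDimensional K E] (U : Submodule K E) (hU : 2 ≤ Module.finrank K U) :
    ∃ H₁ H₂ : Submodule K E, H₁ < U ∧ H₂ < U ∧ H₁ ⊔ H₂ = U := by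
  have hne : U ≠ ⊥ := by
    rintro rfl
    simp at hU
  obtain ⟨x, hxU, hx0⟩ := Submodule.exists_mem_ne_zero_of_ne_bot hne
  have hle : Submodule.span K {x} ≤ U := by simpa using hxU
  obtain ⟨C, hC⟩ := exists_isCompl (Submodule.span K {x})
  have hsup : Submodule.span K {x} ⊔ C ⊓ U = U := by
    rw [← sup_inf_assoc_of_le _ hle, hC.sup_eq_top, top_inf_eq]
  refine ⟨Submodule.span K {x}, C ⊓ U, lt_of_le_of_ne hle ?_, lt_of_le_of_ne inf_le_right ?_, hsup⟩
  · intro h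
    have := finrank_span_singleton (K := K) hx0
    rw [h] at this
    omega
  · intro h
    have h1 : x ∈ C := (inf_eq_right.1 h) hxU
    have h2 := hC.disjoint.le_bot ⟨Submodule.mem_span_singleton_self x, h1⟩
    exact hx0 (by simpa using h2)

/-- Rado's theorem for subspaces: a finite family of subspaces such that any `k` of them span a
space of dimension at least `k` has a linearly independent transversal. -/
theorem exists_linearIndependent_transversal {K E ι : Type*} [Field K] [AddCommGroup E] [Module K E]
    [FiniteDimensional K E] [Fintype ι] [DecidableEq ι] (R : ι → Submodule K E)
    (hR : ∀ S : Finset ι, S.card ≤ Module.finrank K ↥(⨆ j ∈ S, R j)) :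
    ∃ v : ι → E, (∀ i, v i ∈ R i) ∧ LinearIndependent K v := by
  induction hN : ∑ j, Module.finrank K (R j) using Nat.strong_induction_on generalizing R with
  | _ N ih =>
  by_cases hbig : ∃ j, 2 ≤ Module.finrank K (R j)
  · obtain ⟨j, hj⟩ := hbig
    obtain ⟨H₁, H₂, h₁, h₂, h₁₂⟩ := exists_sup_eq_of_two_le_finrank (R j) hj
    -- Induction on the total dimension: shrinking `R j` to `H` is allowed if Rado's condition
    -- survives, and only index sets containing `j` need checking.
    have reduce : ∀ H : Submodule K E, H < R j →
        (∀ S : Finset ι, j ∉ S → S.card + 1 ≤ Module.finrank K ↥(H ⊔ ⨆ i ∈ S, R i)) →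
        ∃ v : ι → E, (∀ i, v i ∈ R i) ∧ LinearIndependent K v := by
      intro H hH hS
      have hle : ∀ i, Function.update R j H i ≤ R i := by
        intro i
        by_cases hij : i = j
        · subst hij; simpa using hH.le
        · simp [hij]
      obtain ⟨v, hv, hvi⟩ := ih (∑ i, Module.finrank K (Function.update R j H i)) (by
          rw [← hN]
          refine Finset.sum_lt_sum (fun i _ => Submodule.finrank_mono (hle i))
            ⟨j, Finset.mem_univ j, ?_⟩
          rw [Function.update_self]
          exact Submodule.finrank_lt_finrank_of_lt hH) (Function.update R j H) (by
          intro S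
          have hcongr : ∀ S' : Finset ι, j ∉ S' →
              (⨆ i ∈ S', Function.update R j H i) = ⨆ i ∈ S', R i := by
            intro S' hjS
            refine iSup_congr fun i => iSup_congr fun hi => ?_
            rw [Function.update_of_ne]
            rintro rfl
            exact hjS hi
          by_cases hjS : j ∈ S
          · rw [← Finset.insert_erase hjS, Finset.iSup_insert, Function.update_self,
              hcongr _ (Finset.notMem_erase j S), Finset.card_insert_of_notMem
              (Finset.notMem_erase j S)]
            exact hS _ (Finset.notMem_erase j S)
          · rw [hcongr S hjS]
            exact hR S) rfl
      exact ⟨v, fun i => hle i (hv i), hvi⟩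
    by_contra hcon
    have hbad : ∀ H : Submodule K E, H < R j →
        ∃ S : Finset ι, j ∉ S ∧ Module.finrank K ↥(H ⊔ ⨆ i ∈ S, R i) ≤ S.card := by
      intro H hH
      by_contra! hno
      exact hcon (reduce H hH fun S hS => hno S hS)
    obtain ⟨S₁, hj₁, hS₁⟩ := hbad H₁ h₁
    obtain ⟨S₂, hj₂, hS₂⟩ := hbad H₂ h₂
    -- If both halves of `R j` violate the condition, the dimension formula bounds sup plus inf by
    -- `S₁.card + S₂.card`. The sup contains all of `R j`, so the hypothesis forces one more.
    have hmod := Submodule.finrank_sup_add_finrank_inf_eq (H₁ ⊔ ⨆ i ∈ S₁, R i) (H₂ ⊔ ⨆ i ∈ S₂, R i)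
    have hjU : j ∉ S₁ ∪ S₂ := by simp [hj₁, hj₂]
    have hsup : (S₁ ∪ S₂).card + 1 ≤
        Module.finrank K ↥((H₁ ⊔ ⨆ i ∈ S₁, R i) ⊔ (H₂ ⊔ ⨆ i ∈ S₂, R i)) := by
      have := hR (insert j (S₁ ∪ S₂))
      rw [Finset.card_insert_of_notMem hjU, Finset.iSup_insert, Finset.iSup_union, ← h₁₂,
        sup_sup_sup_comm] at this
      exact this
    have hinf : (S₁ ∩ S₂).card ≤
        Module.finrank K ↥((H₁ ⊔ ⨆ i ∈ S₁, R i) ⊓ (H₂ ⊔ ⨆ i ∈ S₂, R i)) := by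
      refine (hR (S₁ ∩ S₂)).trans (Submodule.finrank_mono (le_inf ?_ ?_))
      · exact (biSup_mono fun i hi => (Finset.mem_inter.1 hi).1).trans le_sup_right
      · exact (biSup_mono fun i hi => (Finset.mem_inter.1 hi).2).trans le_sup_right
    have hcard := Finset.card_union_add_card_inter S₁ S₂
    omega
  · push Not at hbig
    have hex : ∀ i, ∃ v : E, R i = Submodule.span K {v} := by
      intro i
      have h1 : Module.finrank K (R i) ≤ 1 := by have := hbig i; omega
      obtain ⟨v, hv⟩ := finrank_le_one_iff.1 h1
      refine ⟨v, le_antisymm (fun x hx => ?_) (by simp)⟩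
      obtain ⟨c, hc⟩ := hv ⟨x, hx⟩
      exact Submodule.mem_span_singleton.2 ⟨c, by simpa using congrArg Subtype.val hc⟩
    choose v hv using hex
    refine ⟨v, fun i => hv i ▸ Submodule.mem_span_singleton_self _, ?_⟩
    -- All the subspaces are now spanned by single vectors, and the condition for the full index set
    -- is independence.
    rw [linearIndependent_iff_card_le_finrank_span, Set.finrank]
    have := hR Finset.univ
    have he : ⨆ j ∈ (Finset.univ : Finset ι), R j = Submodule.span K (Set.range v) := by
      simp [hv, Submodule.span_range_eq_iSup]
    rwa [he] at this

/-! ### Stabilisability output-nulling subspaces and the greatest one -/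

section

open Polynomial

namespace LTISystem

variable {n m : ℕ} {κ : Type}

lemma closedLoop_apply (sys : LTISystem n m κ) (F : Matrix (Fin m) (Fin n) ℝ) (v : Fin n → ℝ) :
    sys.closedLoop F v = sys.A *ᵥ v + sys.B *ᵥ (F *ᵥ v) := by
  rw [closedLoop, Matrix.toLin'_apply, Matrix.add_mulVec, Matrix.mulVec_mulVec]

lemma closedLoop_output_apply (sys : LTISystem n m κ) (F : Matrix (Fin m) (Fin n) ℝ)
    (v : Fin n → ℝ) : (sys.C + sys.D * F) *ᵥ v = sys.C *ᵥ v + sys.D *ᵥ (F *ᵥ v) := by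
  rw [Matrix.add_mulVec, Matrix.mulVec_mulVec]

lemma isStabilising_iff (sys : LTISystem n m κ) (T : TimeDomain) (F : Matrix (Fin m) (Fin n) ℝ) :
    sys.IsStabilising T F ↔ ∃ q : ℝ[X], q ≠ 0 ∧ q.rootSet ℂ ⊆ T.stableRegion ∧
      aeval (sys.closedLoop F) q = 0 :=
  realEndSpectrum_subset_iff _ _

/-- Removes the restricted endomorphism: stability on `V` becomes annihilation on `V` by a
polynomial in the full closed loop. -/
lemma isStabOutputNulling_iff (sys : LTISystem n m κ) (T : TimeDomain)
    (V : Submodule ℝ (Fin n → ℝ)) :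
    sys.IsStabOutputNulling T V ↔ ∃ F : Matrix (Fin m) (Fin n) ℝ,
      (∀ v ∈ V, sys.closedLoop F v ∈ V) ∧ (∀ v ∈ V, sys.C *ᵥ v + sys.D *ᵥ (F *ᵥ v) = 0) ∧
      ∃ q : ℝ[X], q ≠ 0 ∧ q.rootSet ℂ ⊆ T.stableRegion ∧
        ∀ v ∈ V, aeval (sys.closedLoop F) q v = 0 := by
  simp only [IsStabOutputNulling, realEndSpectrum_subset_iff, closedLoop_output_apply]
  constructor
  · rintro ⟨F, hV, hout, q, hq0, hqΩ, hq⟩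
    refine ⟨F, hV, hout, q, hq0, hqΩ, fun v hv => ?_⟩
    rw [← aeval_restrict_apply _ V hV q ⟨v, hv⟩, hq]
    rfl
  · rintro ⟨F, hV, hout, q, hq0, hqΩ, hq⟩
    refine ⟨F, hV, hout, q, hq0, hqΩ, ?_⟩
    ext1 v
    apply Subtype.ext
    rw [aeval_restrict_apply, hq v v.2]
    rfl

lemma rootSet_mul_subset {Ω : Set ℂ} {p q : ℝ[X]} (hp : p.rootSet ℂ ⊆ Ω) (hq : q.rootSet ℂ ⊆ Ω)
    (hpq : p * q ≠ 0) : (p * q).rootSet ℂ ⊆ Ω := by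
  intro z hz
  rw [mem_rootSet] at hz
  have h := hz.2
  rw [map_mul, mul_eq_zero] at h
  rcases h with h | h
  · exact hp (mem_rootSet.2 ⟨left_ne_zero_of_mul hpq, h⟩)
  · exact hq (mem_rootSet.2 ⟨right_ne_zero_of_mul hpq, h⟩)

lemma rootSet_X_sub_C_subset {Ω : Set ℂ} {a : ℝ} (ha : (a : ℂ) ∈ Ω) :
    (X - Polynomial.C a : ℝ[X]).rootSet ℂ ⊆ Ω := by
  intro z hz
  have h := (mem_rootSet.1 hz).2
  simp only [map_sub, aeval_X, aeval_C, Complex.coe_algebraMap, sub_eq_zero] at h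
  rwa [h]

/-- A feedback can be modified off `V` so as to take prescribed values on a family which is linearly
independent modulo `V`. -/
lemma exists_feedback_extension (F : Matrix (Fin m) (Fin n) ℝ) (V : Submodule ℝ (Fin n → ℝ))
    {ι : Type*} (v : ι → Fin n → ℝ) (hv : LinearIndependent ℝ (fun i => V.mkQ (v i)))
    (w : ι → Fin m → ℝ) :
    ∃ F' : Matrix (Fin m) (Fin n) ℝ, (∀ x ∈ V, F' *ᵥ x = F *ᵥ x) ∧ ∀ i, F' *ᵥ v i = w i := by
  obtain ⟨g, hg, hgv⟩ := exists_linearMap_extension V F.mulVecLin v hv w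
  refine ⟨LinearMap.toMatrix' g, fun x hx => ?_, fun i => ?_⟩
  · rw [LinearMap.toMatrix'_mulVec]
    exact hg x hx
  · rw [LinearMap.toMatrix'_mulVec]
    exact hgv i

/-- Extension of a stabilisability output-nulling subspace. -/
lemma isStabOutputNulling_of_extension (sys : LTISystem n m κ) (T : TimeDomain)
    {V V' : Submodule ℝ (Fin n → ℝ)} {F F' : Matrix (Fin m) (Fin n) ℝ} {p q : ℝ[X]}
    (hV : ∀ v ∈ V, sys.closedLoop F v ∈ V) (hp0 : p ≠ 0) (hpΩ : p.rootSet ℂ ⊆ T.stableRegion)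
    (hp : ∀ v ∈ V, aeval (sys.closedLoop F) p v = 0)
    (hFF' : ∀ v ∈ V, F' *ᵥ v = F *ᵥ v)
    (hV' : ∀ v ∈ V', sys.closedLoop F' v ∈ V')
    (hout : ∀ v ∈ V', sys.C *ᵥ v + sys.D *ᵥ (F' *ᵥ v) = 0)
    (hq0 : q ≠ 0) (hqΩ : q.rootSet ℂ ⊆ T.stableRegion)
    (hq : ∀ v ∈ V', aeval (sys.closedLoop F') q v ∈ V) :
    sys.IsStabOutputNulling T V' := by
  rw [isStabOutputNulling_iff]
  -- `q` carries `V'` into `V`, where the two closed loops agree and `p` annihilates.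
  refine ⟨F', hV', hout, p * q, mul_ne_zero hp0 hq0,
    rootSet_mul_subset hpΩ hqΩ (mul_ne_zero hp0 hq0), fun v hv => ?_⟩
  rw [map_mul, Module.End.mul_apply, aeval_apply_congr (sys.closedLoop F) (sys.closedLoop F') V hV
    (fun v hv => by rw [closedLoop_apply, closedLoop_apply, hFF' v hv]) p (hq v hv)]
  exact hp _ (hq v hv)

lemma linearIndependent_mkQ_unit (V : Submodule ℝ (Fin n → ℝ)) {x : Fin n → ℝ} (hx : x ∉ V) :
    LinearIndependent ℝ (fun _ : Unit => V.mkQ x) := by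
  rw [linearIndependent_unique_iff]
  simpa using hx

/-- A stabilisability output-nulling subspace can be enlarged by a vector `x` which can be kept
fixed up to a stable factor modulo the subspace while nulling the output. -/
lemma isStabOutputNulling_sup_span_singleton (sys : LTISystem n m κ) (T : TimeDomain)
    {V : Submodule ℝ (Fin n → ℝ)} (hV : sys.IsStabOutputNulling T V) {x : Fin n → ℝ} (hx : x ∉ V)
    {w : Fin m → ℝ} {a : ℝ} (ha : (a : ℂ) ∈ T.stableRegion)
    (hstate : sys.A *ᵥ x + sys.B *ᵥ w - a • x ∈ V) (hout : sys.C *ᵥ x + sys.D *ᵥ w = 0) :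
    sys.IsStabOutputNulling T (V ⊔ Submodule.span ℝ {x}) := by
  obtain ⟨F, hVF, hVout, p, hp0, hpΩ, hp⟩ := (isStabOutputNulling_iff sys T V).1 hV
  obtain ⟨F', hFF', hF'⟩ := exists_feedback_extension F V (fun _ : Unit => x)
    (linearIndependent_mkQ_unit V hx) (fun _ => w)
  replace hF' := hF' ()
  have hV' : ∀ v ∈ V, sys.closedLoop F' v ∈ V := fun v hv => by
    have := hVF v hv
    rw [closedLoop_apply] at this ⊢
    rwa [hFF' v hv]
  have hx' : sys.closedLoop F' x - a • x ∈ V := by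
    rw [closedLoop_apply, hF']
    exact hstate
  -- The closed loop acts as the scalar `a` modulo `V`, so `X - a` serves as the polynomial for the
  -- extension.
  have key : ∀ v ∈ V ⊔ Submodule.span ℝ {x}, sys.closedLoop F' v - a • v ∈ V := by
    intro v hv
    obtain ⟨y, hy, z, hz, rfl⟩ := Submodule.mem_sup.1 hv
    obtain ⟨c, rfl⟩ := Submodule.mem_span_singleton.1 hz
    have : sys.closedLoop F' (y + c • x) - a • (y + c • x) =
        (sys.closedLoop F' y - a • y) + c • (sys.closedLoop F' x - a • x) := by
      rw [map_add, map_smul]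
      module
    rw [this]
    exact V.add_mem (V.sub_mem (hV' y hy) (V.smul_mem a hy)) (V.smul_mem c hx')
  refine isStabOutputNulling_of_extension sys T hVF hp0 hpΩ hp hFF' (fun v hv => ?_)
    (fun v hv => ?_) (X_sub_C_ne_zero a) (rootSet_X_sub_C_subset ha) (fun v hv => ?_)
  · have := Submodule.add_mem _ (Submodule.mem_sup_left (key v hv)) (Submodule.smul_mem _ a hv)
    simpa using this
  · obtain ⟨y, hy, z, hz, rfl⟩ := Submodule.mem_sup.1 hv
    obtain ⟨c, rfl⟩ := Submodule.mem_span_singleton.1 hz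
    have h1 := hVout y hy
    rw [← hFF' y hy] at h1
    have : sys.C *ᵥ (y + c • x) + sys.D *ᵥ (F' *ᵥ (y + c • x)) =
        (sys.C *ᵥ y + sys.D *ᵥ (F' *ᵥ y)) + c • (sys.C *ᵥ x + sys.D *ᵥ w) := by
      rw [← hF']
      simp only [Matrix.mulVec_add, Matrix.mulVec_smul]
      module
    rw [this, h1, hout, smul_zero, add_zero]
  · simpa [Module.algebraMap_end_apply] using key v hv

/-- Provides a target for a mode that can be placed freely. -/
lemma exists_real_mem_stableRegion (T : TimeDomain) : ∃ a : ℝ, (a : ℂ) ∈ T.stableRegion := by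
  cases T
  · exact ⟨-1, by simp [TimeDomain.stableRegion]⟩
  · exact ⟨0, by simp [TimeDomain.stableRegion]⟩

/-- Applying the irreducible factors of `p` to `y` one after another, some factor makes the passage
from outside `V` into `V`. Over `ℝ` it has degree at most two, so one or two new directions suffice
to enlarge `V`. Invariance of `V` under `f` is not available in the application. -/
lemma exists_irreducible_factor_crossing {K E : Type*} [Field K] [AddCommGroup E] [Module K E]
    (f : E →ₗ[K] E) (U V : Submodule K E) (hU : ∀ v ∈ U, f v ∈ U) (p : K[X]) (hp : p ≠ 0)
    {y : E} (hyU : y ∈ U) (hyV : y ∉ V) (hpy : aeval f p y ∈ V) :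
    ∃ q : K[X], Irreducible q ∧ q ∣ p ∧ ∃ x ∈ U, x ∉ V ∧ aeval f q x ∈ V := by
  induction p using WfDvdMonoid.induction_on_irreducible with
  | zero => exact absurd rfl hp
  | unit u hu =>
    obtain ⟨c, hc, rfl⟩ := Polynomial.isUnit_iff.1 hu
    rw [aeval_C, Module.algebraMap_end_apply] at hpy
    exact absurd ((V.smul_mem_iff hc.ne_zero).1 hpy) hyV
  | mul a i ha hi ih =>
    by_cases h : aeval f a y ∈ V
    · obtain ⟨q, hq, hqa, hx⟩ := ih ha h
      exact ⟨q, hq, hqa.mul_left i, hx⟩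
    · refine ⟨i, hi, dvd_mul_right i a, aeval f a y, aeval_apply_mem f U hU a hyU, h, ?_⟩
      rwa [map_mul, Module.End.mul_apply] at hpy

lemma linearIndependent_mkQ_pair {K E : Type*} [Field K] [AddCommGroup E] [Module K E]
    (V : Submodule K E) {x y : E} (hx : x ∉ V) (hy : ∀ c : K, y - c • x ∉ V) :
    LinearIndependent K (fun i : Fin 2 => V.mkQ (![x, y] i)) := by
  have hx' : V.mkQ x ≠ 0 := by simpa using hx
  have h := (LinearIndependent.pair_iff' (y := V.mkQ y) hx').2 fun c hc => hy c (by
    rw [← map_smul, Submodule.mkQ_apply, Submodule.mkQ_apply, eq_comm,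
      Submodule.Quotient.eq] at hc
    exact hc)
  have he : (fun i : Fin 2 => V.mkQ (![x, y] i)) = ![V.mkQ x, V.mkQ y] := by
    ext1 i
    fin_cases i <;> rfl
  rw [he]
  exact h

/-- If a stabilisability output-nulling subspace is not contained in another one `V`, then `V` can
be properly enlarged. -/
lemma exists_isStabOutputNulling_gt (sys : LTISystem n m κ) (T : TimeDomain)
    {V U : Submodule ℝ (Fin n → ℝ)} (hV : sys.IsStabOutputNulling T V)
    (hU : sys.IsStabOutputNulling T U) (hUV : ¬ U ≤ V) :
    ∃ V', sys.IsStabOutputNulling T V' ∧ V < V' := by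
  obtain ⟨F, hVF, hVout, p, hp0, hpΩ, hp⟩ := (isStabOutputNulling_iff sys T V).1 hV
  obtain ⟨G, hUG, hUout, s, hs0, hsΩ, hs⟩ := (isStabOutputNulling_iff sys T U).1 hU
  obtain ⟨y, hyU, hyV⟩ := Set.not_subset.1 hUV
  obtain ⟨q, hqirr, hqs, x, hxU, hxV, hqx⟩ := exists_irreducible_factor_crossing
    (sys.closedLoop G) U V hUG s hs0 hyU hyV (by rw [hs y hyU]; exact V.zero_mem)
  have hqΩ : q.rootSet ℂ ⊆ T.stableRegion := by
    obtain ⟨r, rfl⟩ := hqs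
    intro z hz
    refine hsΩ (mem_rootSet.2 ⟨hs0, ?_⟩)
    rw [map_mul, (mem_rootSet.1 hz).2, zero_mul]
  have hlt : V < V ⊔ Submodule.span ℝ {x} := by
    refine lt_of_le_of_ne le_sup_left fun h => hxV ?_
    rw [h]
    exact Submodule.mem_sup_right (Submodule.mem_span_singleton_self x)
  set f := sys.closedLoop G with hf
  obtain ⟨a, b, c, hq⟩ : ∃ a b c : ℝ, q = Polynomial.C a * X ^ 2 + Polynomial.C b * X + Polynomial.C c :=
    ⟨_, _, _, eq_quadratic_of_degree_le_two hqirr.degree_le_two⟩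
  have hqf : ∀ u, aeval f q u = a • f (f u) + b • f u + c • u := by
    intro u
    simp [hq, pow_two, Module.algebraMap_end_apply]
  rw [hqf] at hqx
  -- Since `V` need not be `f`-invariant, `f x ≡ l x` modulo `V` does not make `l` a root of `q`.
  by_cases hdep : ∃ l : ℝ, f x - l • x ∈ V
  · obtain ⟨l, hl⟩ := hdep
    by_cases hroot : a * l ^ 2 + b * l + c = 0
    · refine ⟨_, isStabOutputNulling_sup_span_singleton sys T hV hxV (w := G *ᵥ x) (a := l) ?_ ?_ ?_, hlt⟩
      · refine hqΩ (mem_rootSet.2 ⟨hqirr.ne_zero, ?_⟩)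
        have : ((a * l ^ 2 + b * l + c : ℝ) : ℂ) = 0 := by rw [hroot]; simp
        simpa [hq] using this
      · rwa [← closedLoop_apply]
      · exact hUout x hxU
    -- Here `v` lies in `U ⊓ V`, where both `G` and `F` null the output, so adding multiples of `G v
    -- - F v` to the input at `x` leaves the output unchanged. Modulo `V` this input produces `f v`,
    -- with `a f v ≡ -q(l) x` and `q(l) ≠ 0`. The mode of `x` can thus be moved from `l` to any
    -- stable `r`, which determines the coefficient `(l - r) d⁻¹ a` below.
    · set v := f x - l • x with hv
      have hvU : v ∈ U := U.sub_mem (hUG x hxU) (U.smul_mem l hxU)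
      have h1 : (a * l ^ 2 + b * l + c) • x + a • f v ∈ V := by
        have : (a * l ^ 2 + b * l + c) • x + a • f v =
            a • f (f x) + b • f x + c • x - (a * l + b) • v := by
          rw [hv, map_sub, map_smul]
          module
        rw [this]
        exact V.sub_mem hqx (V.smul_mem _ hl)
      set d := a * l ^ 2 + b * l + c with hd
      obtain ⟨r, hr⟩ := exists_real_mem_stableRegion T
      refine ⟨_, isStabOutputNulling_sup_span_singleton sys T hV hxV
        (w := G *ᵥ x + ((l - r) * d⁻¹ * a) • (G *ᵥ v - F *ᵥ v)) (a := r) hr ?_ ?_, hlt⟩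
      · have h2 : sys.A *ᵥ x + sys.B *ᵥ (G *ᵥ x + ((l - r) * d⁻¹ * a) • (G *ᵥ v - F *ᵥ v)) - r • x
            = (f x - l • x) + ((l - r) * d⁻¹) • (d • x + a • f v)
              - ((l - r) * d⁻¹ * a) • sys.closedLoop F v := by
          have h3 : ((l - r) * d⁻¹) • (d • x + a • f v) =
              (l - r) • x + ((l - r) * d⁻¹ * a) • f v := by
            rw [smul_add, smul_smul, smul_smul, mul_assoc, inv_mul_cancel₀ hroot, mul_one]
          rw [h3, hf, closedLoop_apply, closedLoop_apply, closedLoop_apply, Matrix.mulVec_add,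
            Matrix.mulVec_smul, Matrix.mulVec_sub]
          module
        rw [h2]
        exact V.sub_mem (V.add_mem hl (V.smul_mem _ h1)) (V.smul_mem _ (hVF v hl))
      · have h2 : sys.C *ᵥ x + sys.D *ᵥ (G *ᵥ x + ((l - r) * d⁻¹ * a) • (G *ᵥ v - F *ᵥ v)) =
            (sys.C *ᵥ x + sys.D *ᵥ (G *ᵥ x)) + ((l - r) * d⁻¹ * a) •
              ((sys.C *ᵥ v + sys.D *ᵥ (G *ᵥ v)) - (sys.C *ᵥ v + sys.D *ᵥ (F *ᵥ v))) := by
          simp only [Matrix.mulVec_add, Matrix.mulVec_smul, Matrix.mulVec_sub]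
          module
        rw [h2, hUout x hxU, hUout v hvU, hVout v hl]
        simp
  · push Not at hdep
    -- If `a = 0`, then `q(f) x ∈ V` would put `x` in `V` or make `f x` a multiple of `x` modulo
    -- `V`.
    have ha : a ≠ 0 := by
      rintro rfl
      by_cases hb : b = 0
      · subst hb
        have hc : c ≠ 0 := by
          rintro rfl
          exact hqirr.ne_zero (by simp [hq])
        simp only [zero_smul, zero_add] at hqx
        exact hxV ((V.smul_mem_iff hc).1 hqx)
      · apply hdep (-(b⁻¹ * c))
        have := V.smul_mem b⁻¹ hqx
        have h2 : f x - (-(b⁻¹ * c)) • x = b⁻¹ • ((0 : ℝ) • f (f x) + b • f x + c • x) := by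
          rw [smul_add, smul_add, smul_smul, smul_smul, smul_smul, inv_mul_cancel₀ hb]
          module
        rwa [h2]
    -- Copying `G` on both `x` and `f x` makes the new closed loop `g` satisfy `q(g) x = q(f) x ∈
    -- V`, so `q` carries the enlarged space into `V`.
    obtain ⟨F', hFF', hF'⟩ := exists_feedback_extension F V ![x, f x]
      (linearIndependent_mkQ_pair V hxV hdep) ![G *ᵥ x, G *ᵥ f x]
    have hF'x : F' *ᵥ x = G *ᵥ x := hF' 0
    have hF'fx : F' *ᵥ f x = G *ᵥ f x := hF' 1
    set g := sys.closedLoop F' with hg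
    have hgV : ∀ v ∈ V, g v ∈ V := fun v hv => by
      have := hVF v hv
      rw [hg, closedLoop_apply]
      rw [closedLoop_apply] at this
      rwa [hFF' v hv]
    have hgx : g x = f x := by rw [hg, hf, closedLoop_apply, closedLoop_apply, hF'x]
    have hgfx : g (f x) = f (f x) := by
      rw [hg, closedLoop_apply, hF'fx, ← closedLoop_apply]
    have hqg : ∀ u, aeval g q u = a • g (g u) + b • g u + c • u := by
      intro u
      simp [hq, pow_two, Module.algebraMap_end_apply]
    have hrep : ∀ v ∈ V ⊔ Submodule.span ℝ {x, f x}, ∃ y ∈ V, ∃ α β : ℝ,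
        v = y + (α • x + β • f x) := by
      intro v hv
      obtain ⟨y, hy, z, hz, rfl⟩ := Submodule.mem_sup.1 hv
      obtain ⟨α, β, rfl⟩ := Submodule.mem_span_pair.1 hz
      exact ⟨y, hy, α, β, rfl⟩
    have hmem : ∀ y ∈ V, ∀ α β : ℝ, y + (α • x + β • f x) ∈ V ⊔ Submodule.span ℝ {x, f x} :=
      fun y hy α β => Submodule.add_mem_sup hy (Submodule.mem_span_pair.2 ⟨α, β, rfl⟩)
    have hqgx : aeval g q x ∈ V := by
      rw [hqg, hgx, hgfx]
      exact hqx
    have hqgfx : aeval g q (f x) ∈ V := by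
      have h2 : aeval g q (f x) = g (aeval g q x) := by
        rw [hqg, hqg, map_add, map_add, map_smul, map_smul, map_smul, hgx]
      rw [h2]
      exact hgV _ hqgx
    refine ⟨V ⊔ Submodule.span ℝ {x, f x}, isStabOutputNulling_of_extension sys T hVF hp0 hpΩ hp
      hFF' (fun v hv => ?_) (fun v hv => ?_) hqirr.ne_zero hqΩ (fun v hv => ?_), hlt.trans_le
        (sup_le_sup_left (Submodule.span_mono (by simp)) V)⟩
    · obtain ⟨y, hy, α, β, rfl⟩ := hrep v hv
      -- As `a ≠ 0`, the relation `q(f) x ∈ V` expresses `f (f x)` through `x` and `f x` modulo `V`.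
      have h2 : g (y + (α • x + β • f x)) =
          (g y + (β * a⁻¹) • (a • f (f x) + b • f x + c • x)) +
            ((-(β * a⁻¹ * c)) • x + (α - β * a⁻¹ * b) • f x) := by
        have h3 : (β * a⁻¹) • (a • f (f x) + b • f x + c • x) =
            β • f (f x) + (β * a⁻¹ * b) • f x + (β * a⁻¹ * c) • x := by
          rw [smul_add, smul_add, smul_smul, smul_smul, smul_smul, mul_assoc β a⁻¹ a,
            inv_mul_cancel₀ ha, mul_one]
        rw [h3, map_add, map_add, map_smul, map_smul, hgx, hgfx]
        module
      rw [← hg, h2]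
      exact hmem _ (V.add_mem (hgV y hy) (V.smul_mem _ hqx)) _ _
    · obtain ⟨y, hy, α, β, rfl⟩ := hrep v hv
      have h2 : sys.C *ᵥ (y + (α • x + β • f x)) + sys.D *ᵥ (F' *ᵥ (y + (α • x + β • f x))) =
          (sys.C *ᵥ y + sys.D *ᵥ (F *ᵥ y)) + (α • (sys.C *ᵥ x + sys.D *ᵥ (G *ᵥ x)) +
            β • (sys.C *ᵥ f x + sys.D *ᵥ (G *ᵥ f x))) := by
        rw [← hFF' y hy, ← hF'x, ← hF'fx]
        simp only [Matrix.mulVec_add, Matrix.mulVec_smul]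
        module
      rw [h2, hVout y hy, hUout x hxU, hUout _ (hUG x hxU)]
      simp
    · obtain ⟨y, hy, α, β, rfl⟩ := hrep v hv
      rw [map_add, map_add, map_smul, map_smul]
      exact V.add_mem (aeval_apply_mem g V hgV q hy)
        (V.add_mem (V.smul_mem _ hqgx) (V.smul_mem _ hqgfx))

lemma isStabOutputNulling_bot (sys : LTISystem n m κ) (T : TimeDomain) :
    sys.IsStabOutputNulling T ⊥ := by
  rw [isStabOutputNulling_iff]
  refine ⟨0, ?_, ?_, 1, one_ne_zero, by simp, ?_⟩ <;> simp

/-- `𝒱*_g` is itself a stabilisability output-nulling subspace. -/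
theorem isStabOutputNulling_Vg (sys : LTISystem n m κ) (T : TimeDomain) :
    sys.IsStabOutputNulling T (sys.Vg T) := by
  -- In finite dimension a maximal such subspace exists; since any other one not inside it would
  -- allow an enlargement, it is the greatest.
  obtain ⟨V, hV, hmax⟩ := WellFounded.has_min
    (wellFounded_gt (α := Submodule ℝ (Fin n → ℝ))) {V | sys.IsStabOutputNulling T V}
    ⟨⊥, isStabOutputNulling_bot sys T⟩
  have hle : ∀ U, sys.IsStabOutputNulling T U → U ≤ V := by
    intro U hU
    by_contra h
    obtain ⟨V', hV', hlt⟩ := exists_isStabOutputNulling_gt sys T hV hU h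
    exact hmax V' hV' hlt
  have : sys.Vg T = V := le_antisymm (sSup_le hle) (le_sSup hV)
  rwa [this]

end LTISystem

end

namespace LTISystem

/-! ### Error dynamics under the tracking law -/

section Tracking

variable {n m : ℕ} {κ : Type}

lemma steadyState_error (sys : LTISystem n m κ) {T : TimeDomain} {r : κ → ℝ} {xss : Fin n → ℝ}
    {uss : Fin m → ℝ} (h : sys.IsSteadyState T r xss uss) (F : Matrix (Fin m) (Fin n) ℝ)
    (x : Fin n → ℝ) :
    sys.A *ᵥ x + sys.B *ᵥ (F *ᵥ (x - xss) + uss) =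
        sys.closedLoop F (x - xss) + T.steadyFreq • xss ∧
      sys.C *ᵥ x + sys.D *ᵥ (F *ᵥ (x - xss) + uss) - r = (sys.C + sys.D * F) *ᵥ (x - xss) := by
  rw [closedLoop_apply, closedLoop_output_apply, h.1, h.2]
  simp only [Matrix.mulVec_add, Matrix.mulVec_sub]
  constructor <;> abel

/-- A function with `z' = a z` on `[0, ∞)` is an exponential. -/
lemma eq_mul_exp_of_hasDerivWithinAt {z : ℝ → ℝ} {a : ℝ}
    (hz : ∀ t, 0 ≤ t → HasDerivWithinAt z (a * z t) (Set.Ici 0) t) {t : ℝ} (ht : 0 ≤ t) :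
    z t = z 0 * Real.exp (a * t) := by
  -- Integrating factor: `z s * exp (-(a * s))` is constant.
  have hd : ∀ s, 0 ≤ s →
      HasDerivWithinAt (fun s => z s * Real.exp (-(a * s))) 0 (Set.Ici 0) s := by
    intro s hs
    have h1 : HasDerivAt (fun s => Real.exp (-(a * s))) (Real.exp (-(a * s)) * (-(a * 1))) s :=
      (((hasDerivAt_id s).const_mul a).neg).exp
    have h2 := (hz s hs).mul h1.hasDerivWithinAt
    refine h2.congr_deriv ?_
    ring
  have hconst := constant_of_has_deriv_right_zero (a := 0) (b := t)
    (f := fun s => z s * Real.exp (-(a * s)))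
    (fun s hs => ((hd s hs.1).continuousWithinAt).mono Set.Icc_subset_Ici_self)
    (fun s hs => (hd s hs.1).mono (Set.Ici_subset_Ici.2 hs.1)) t ⟨ht, le_rfl⟩
  simp only [mul_zero, neg_zero, Real.exp_zero, mul_one] at hconst
  rw [← hconst, mul_assoc, ← Real.exp_add]
  simp

/-- The feedback `F` yields single-mode tracking errors iff each row of `C + DF` is a left
eigenvector of `A + BF` (or zero) for the prescribed mode. -/
lemma forall_hasSingleModeError_iff (sys : LTISystem n m κ) (T : TimeDomain) (lam : κ → ℝ)
    (F : Matrix (Fin m) (Fin n) ℝ) :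
    (∀ (r : κ → ℝ) (xss : Fin n → ℝ) (uss : Fin m → ℝ),
        sys.IsSteadyState T r xss uss → sys.HasSingleModeError T lam F r xss uss) ↔
      ∀ x k, ((sys.C + sys.D * F) *ᵥ sys.closedLoop F x) k =
        lam k * ((sys.C + sys.D * F) *ᵥ x) k := by
  constructor
  · intro h x₀ k
    -- The zero reference with arbitrary initial state suffices: compare times `0` and `1` in
    -- discrete time, or differentiate the output at `0` in two ways in continuous time.
    have hss : sys.IsSteadyState T 0 0 0 := by simp [IsSteadyState]
    have h0 := h 0 0 0 hss
    have herr := steadyState_error sys hss F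
    simp only [sub_zero, add_zero, smul_zero] at herr
    cases T with
    | discrete =>
      obtain ⟨β, hβ⟩ := h0 (fun t => (sys.closedLoop F ^ t) x₀)
        (fun t => F *ᵥ (sys.closedLoop F ^ t) x₀) (fun t => by simp) (fun t => by
          rw [(herr _).1, pow_succ', Module.End.mul_apply])
      have h1 := hβ 0 k
      have h2 := hβ 1 k
      simp only [sub_zero, (herr _).2] at h1 h2
      simp only [pow_zero, pow_one, Module.End.one_apply, mul_one] at h1 h2
      rw [h2, h1, mul_comm]
    | continuous =>
      set L := LinearMap.toContinuousLinearMap (sys.closedLoop F) with hL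
      have hx : ∀ t : ℝ, HasDerivAt (fun t : ℝ => NormedSpace.exp (t • L) x₀)
          (sys.closedLoop F (NormedSpace.exp (t • L) x₀)) t := by
        intro t
        have := (hasDerivAt_exp_smul_const' (𝕂 := ℝ) L t).clm_apply (hasDerivAt_const t x₀)
        simpa [hL] using this
      obtain ⟨β, hβ⟩ := h0 (fun t => NormedSpace.exp (t • L) x₀)
        (fun t => F *ᵥ (NormedSpace.exp (t • L) x₀)) (fun t _ => by simp) (fun t _ => by
          rw [(herr _).1]
          exact (hx t).hasDerivWithinAt)
      simp only [sub_zero, (herr _).2] at hβ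
      let φ : (Fin n → ℝ) →L[ℝ] ℝ := LinearMap.toContinuousLinearMap
        (LinearMap.proj k ∘ₗ (sys.C + sys.D * F).mulVecLin)
      have hφ : ∀ v, φ v = ((sys.C + sys.D * F) *ᵥ v) k := fun v => rfl
      have hd1 : HasDerivWithinAt (fun t : ℝ => φ (NormedSpace.exp (t • L) x₀))
          (φ (sys.closedLoop F x₀)) (Set.Ici 0) 0 := by
        have := φ.hasFDerivAt.comp_hasDerivAt (0 : ℝ) (hx 0)
        refine this.hasDerivWithinAt.congr_deriv ?_
        simp
      have hd2 : HasDerivWithinAt (fun t : ℝ => φ (NormedSpace.exp (t • L) x₀))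
          (β k * lam k) (Set.Ici 0) 0 := by
        have h1 : HasDerivAt (fun t : ℝ => β k * Real.exp (lam k * t))
            (β k * (Real.exp (lam k * 0) * (lam k * 1))) 0 :=
          (((hasDerivAt_id (0 : ℝ)).const_mul (lam k)).exp).const_mul (β k)
        refine (h1.hasDerivWithinAt.congr (fun t ht => hβ t ht k) (hβ 0 le_rfl k)).congr_deriv ?_
        simp
      have heq := (uniqueDiffOn_Ici (0 : ℝ) 0 Set.self_mem_Ici).eq_deriv _ hd1 hd2
      have hβ0 := hβ 0 le_rfl k
      simp only [zero_smul, NormedSpace.exp_zero, one_apply_eq_self, mul_zero,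
        Real.exp_zero, mul_one] at hβ0
      rw [← hφ, heq, hβ0, mul_comm]
  · intro h r xss uss hss
    have herr := steadyState_error sys hss F
    cases T with
    | discrete =>
      intro x u hu hx
      have hstep : ∀ t, x (t + 1) - xss = sys.closedLoop F (x t - xss) := by
        intro t
        rw [hx, hu, (herr _).1]
        simp [TimeDomain.steadyFreq]
      refine ⟨fun k => ((sys.C + sys.D * F) *ᵥ (x 0 - xss)) k, fun t k => ?_⟩
      rw [hu, (herr _).2]
      induction t with
      | zero => simp
      | succ t ih => rw [hstep, h, ih, pow_succ]; ring
    | continuous =>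
      intro x u hu hx
      refine ⟨fun k => ((sys.C + sys.D * F) *ᵥ (x 0 - xss)) k, fun t ht k => ?_⟩
      rw [hu t ht, (herr _).2]
      let φ : (Fin n → ℝ) →L[ℝ] ℝ := LinearMap.toContinuousLinearMap
        (LinearMap.proj k ∘ₗ (sys.C + sys.D * F).mulVecLin)
      refine eq_mul_exp_of_hasDerivWithinAt (z := fun t => φ (x t - xss)) (fun s hs => ?_) ht
      have h1 := φ.hasFDerivAt.comp_hasDerivWithinAt s ((hx s hs).sub_const xss)
      rw [hu s hs, (herr _).1] at h1
      refine h1.congr_deriv ?_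
      simp only [TimeDomain.steadyFreq, zero_smul, add_zero]
      exact h _ k

end Tracking

/-! ### Surjectivity of the Rosenbrock matrix -/

section Rosenbrock

variable {n m : ℕ} {κ : Type}

open Polynomial in
/-- A polynomial matrix which is right invertible over the field of rational functions is right
invertible at some point. -/
lemma exists_eval_mul_eq_one {K α β : Type*} [Field K] [Infinite K] [Finite α] [Fintype β]
    [DecidableEq α] (P : Matrix α β K[X]) (M : Matrix β α (RatFunc K))
    (h : P.map (algebraMap K[X] (RatFunc K)) * M = 1) :
    ∃ (z : K) (N : Matrix β α K), P.map (eval z) * N = 1 := by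
  -- Clear denominators to get `P * N' = d • 1`, then evaluate where the nonzero polynomial `d` does
  -- not vanish.
  obtain ⟨d, hd⟩ := IsLocalization.exist_integer_multiples_of_finite (nonZeroDivisors K[X])
    (fun ij : β × α => M ij.1 ij.2)
  choose N hN using hd
  let N' : Matrix β α K[X] := Matrix.of fun i j => N (i, j)
  have hN' : N'.map (algebraMap K[X] (RatFunc K)) = algebraMap K[X] (RatFunc K) d • M := by
    ext i j
    have := hN (i, j)
    rw [Algebra.smul_def] at this
    simpa [N'] using this
  have hPN : P * N' = (d : K[X]) • (1 : Matrix α α K[X]) := by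
    apply Matrix.map_injective (RatFunc.algebraMap_injective K)
    dsimp only
    rw [Matrix.map_mul, hN', Matrix.mul_smul, h]
    ext i j
    by_cases hij : i = j <;> simp [hij]
  have hd0 : (d : K[X]) ≠ 0 := nonZeroDivisors.coe_ne_zero d
  obtain ⟨z, hz⟩ : ∃ z, eval z (d : K[X]) ≠ 0 := by
    by_contra! hall
    exact hd0 (Polynomial.funext fun z => by simp [hall])
  refine ⟨z, (eval z (d : K[X]))⁻¹ • N'.map (eval z), ?_⟩
  have hev := congrArg (fun A : Matrix α α K[X] => A.map (evalRingHom z)) hPN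
  rw [Matrix.map_mul] at hev
  rw [Matrix.mul_smul]
  change _ • (P.map (evalRingHom z) * N'.map (evalRingHom z)) = 1
  rw [hev]
  ext i j
  by_cases hij : i = j <;> simp [Matrix.one_apply, hij, hz]

/-- If the transfer matrix is right invertible, then so is the Rosenbrock matrix over `ℝ(s)`. -/
lemma RightInvertible.exists_rosenbrock_ratFunc_mul_eq_one [Fintype κ] [DecidableEq κ]
    (sys : LTISystem n m κ) (h : sys.RightInvertible) :
    ∃ M : Matrix (Fin n ⊕ Fin m) (Fin n ⊕ κ) (RatFunc ℝ),
      sys.rosenbrock (RatFunc ℝ) RatFunc.X * M = 1 := by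
  obtain ⟨R, hR⟩ := h
  rw [transferMatrix] at hR
  set X' : Matrix (Fin n) (Fin n) (RatFunc ℝ) :=
    (RatFunc.X : RatFunc ℝ) • (1 : Matrix (Fin n) (Fin n) (RatFunc ℝ)) -
      sys.A.map (algebraMap ℝ (RatFunc ℝ)) with hX
  have hX' : X' = (Matrix.charmatrix sys.A).map (algebraMap (Polynomial ℝ) (RatFunc ℝ)) := by
    ext i j
    by_cases hij : i = j <;>
      simp [hX, hij, RatFunc.algebraMap_X,
        RatFunc.algebraMap_C, RatFunc.algebraMap_eq_C]
  have hdet : IsUnit X'.det := by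
    rw [hX', ← RingHom.mapMatrix_apply, ← RingHom.map_det, isUnit_iff_ne_zero]
    exact (map_ne_zero_iff _ (RatFunc.algebraMap_injective ℝ)).2 sys.A.charpoly_monic.ne_zero
  have hQ : X' * X'⁻¹ = 1 := Matrix.mul_nonsing_inv _ hdet
  have hA : sys.A.map (algebraMap ℝ (RatFunc ℝ)) - (RatFunc.X : RatFunc ℝ) • 1 = -X' := by
    rw [hX, neg_sub]
  rw [rosenbrock, hA]
  generalize sys.B.map (algebraMap ℝ (RatFunc ℝ)) = B at *
  generalize sys.C.map (algebraMap ℝ (RatFunc ℝ)) = C at *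
  generalize sys.D.map (algebraMap ℝ (RatFunc ℝ)) = D at *
  generalize X'⁻¹ = Q at *
  have hDR : D * R = 1 - C * Q * B * R := by rw [← hR, Matrix.add_mul]; abel
  -- Block elimination with pivot `-X'`, where `Q = X'⁻¹`: the Schur complement `D + C Q B` is the
  -- transfer matrix, with right inverse `R`.
  refine ⟨Matrix.fromBlocks (-Q + Q * B * R * C * Q) (Q * B * R) (R * C * Q) R, ?_⟩
  rw [Matrix.fromBlocks_multiply, ← Matrix.fromBlocks_one]
  congr 1
  · have : X' * (Q * B * R * C * Q) = X' * Q * (B * R * C * Q) := by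
      simp only [Matrix.mul_assoc]
    rw [mul_add, neg_mul_neg, neg_mul, this, hQ]
    simp only [Matrix.mul_assoc, Matrix.one_mul]
    abel
  · have : X' * (Q * B * R) = X' * Q * (B * R) := by simp only [Matrix.mul_assoc]
    rw [Matrix.neg_mul, this, hQ, Matrix.one_mul, neg_add_cancel]
  · have : D * (R * C * Q) = D * R * (C * Q) := by simp only [Matrix.mul_assoc]
    rw [this, hDR]
    simp only [Matrix.mul_add, Matrix.sub_mul, Matrix.mul_neg, Matrix.mul_assoc, Matrix.one_mul]
    abel
  · rw [hDR]
    simp only [Matrix.mul_assoc]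
    abel

open Polynomial in
/-- If the transfer matrix is right invertible, the Rosenbrock matrix is right invertible at some
real point. -/
lemma RightInvertible.exists_rosenbrock_mul_eq_one [Fintype κ] [DecidableEq κ]
    (sys : LTISystem n m κ) (h : sys.RightInvertible) :
    ∃ (z : ℝ) (N : Matrix (Fin n ⊕ Fin m) (Fin n ⊕ κ) ℝ), sys.rosenbrock ℝ z * N = 1 := by
  obtain ⟨M, hM⟩ := RightInvertible.exists_rosenbrock_ratFunc_mul_eq_one sys h
  let P : Matrix (Fin n ⊕ κ) (Fin n ⊕ Fin m) ℝ[X] :=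
    Matrix.fromBlocks (sys.A.map Polynomial.C - (X : ℝ[X]) • 1) (sys.B.map Polynomial.C)
      (sys.C.map Polynomial.C) (sys.D.map Polynomial.C)
  have hP : P.map (algebraMap ℝ[X] (RatFunc ℝ)) = sys.rosenbrock (RatFunc ℝ) RatFunc.X := by
    ext i j
    rcases i with i | i <;> rcases j with j | j <;>
      simp [P, rosenbrock, RatFunc.algebraMap_C, RatFunc.algebraMap_eq_C,
        Matrix.one_apply]
    split_ifs <;> simp
  obtain ⟨z, N, hN⟩ := exists_eval_mul_eq_one P M (hP ▸ hM)
  refine ⟨z, N, ?_⟩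
  rw [← hN]
  congr 1
  ext i j
  rcases i with i | i <;> rcases j with j | j <;> simp [P, rosenbrock, Matrix.one_apply]
  split_ifs <;> simp

lemma normalRank_bddAbove [Fintype κ] (sys : LTISystem n m κ) :
    BddAbove (Set.range fun z : ℂ => (sys.rosenbrock ℂ z).rank) := by
  refine ⟨Fintype.card (Fin n ⊕ Fin m), ?_⟩
  rintro _ ⟨z, rfl⟩
  exact Matrix.rank_le_card_width _

lemma rosenbrock_map (sys : LTISystem n m κ) (z : ℝ) :
    (sys.rosenbrock ℝ z).map (algebraMap ℝ ℂ) = sys.rosenbrock ℂ (z : ℂ) := by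
  ext i j
  rcases i with i | i <;> rcases j with j | j <;>
    simp [rosenbrock, Matrix.one_apply]
  split_ifs <;> simp

/-- For a right-invertible system, the Rosenbrock matrix at a real number which is not an invariant
zero is surjective. -/
lemma RightInvertible.rosenbrock_surjective [Fintype κ] [DecidableEq κ]
    (sys : LTISystem n m κ) (h : sys.RightInvertible) {z : ℝ}
    (hz : (z : ℂ) ∉ sys.invariantZeros) (b : Fin n ⊕ κ → ℝ) :
    ∃ v, sys.rosenbrock ℝ z *ᵥ v = b := by
  obtain ⟨z₀, N, hN⟩ := RightInvertible.exists_rosenbrock_mul_eq_one sys h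
  have hN' : sys.rosenbrock ℂ (z₀ : ℂ) * N.map (algebraMap ℝ ℂ) = 1 := by
    rw [← rosenbrock_map, ← Matrix.map_mul, hN]
    simp
  have hrank₀ : Fintype.card (Fin n ⊕ κ) ≤ (sys.rosenbrock ℂ (z₀ : ℂ)).rank := by
    rw [← Matrix.rank_one (R := ℂ) (n := Fin n ⊕ κ), ← hN']
    exact Matrix.rank_mul_le_left _ _
  have hrank : Fintype.card (Fin n ⊕ κ) ≤ (sys.rosenbrock ℂ (z : ℂ)).rank :=
    (hrank₀.trans (le_ciSup (normalRank_bddAbove sys) (z₀ : ℂ))).trans (not_lt.1 hz)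
  have htop : LinearMap.range (sys.rosenbrock ℂ (z : ℂ)).mulVecLin = ⊤ := by
    apply Submodule.eq_top_of_finrank_eq
    refine le_antisymm (Submodule.finrank_le _) ?_
    rw [Module.finrank_fintype_fun_eq_card]
    exact hrank
  obtain ⟨v, hv⟩ : (fun i => (b i : ℂ)) ∈ LinearMap.range (sys.rosenbrock ℂ (z : ℂ)).mulVecLin :=
    htop ▸ Submodule.mem_top
  -- The matrix and the right-hand side are real, so the real part of a complex solution is a
  -- solution.
  refine ⟨fun i => (v i).re, ?_⟩
  ext i
  have := congrArg Complex.re (congrFun hv i)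
  rw [← rosenbrock_map] at this
  simpa [Matrix.mulVec, dotProduct] using this

lemma mulVec_rosenbrock (sys : LTISystem n m κ) (z : ℝ) (x : Fin n → ℝ) (w : Fin m → ℝ) :
    sys.rosenbrock ℝ z *ᵥ Sum.elim x w =
      Sum.elim (sys.A *ᵥ x + sys.B *ᵥ w - z • x) (sys.C *ᵥ x + sys.D *ᵥ w) := by
  have : ∀ {a b : Type} (M : Matrix a b ℝ), M.map (algebraMap ℝ ℝ) = M := fun M => by ext; simp
  rw [rosenbrock, Matrix.fromBlocks_mulVec, this, this, this, this]
  congr 1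
  simp only [Sum.elim_comp_inl, Sum.elim_comp_inr, Matrix.sub_mulVec, Matrix.smul_mulVec,
    Matrix.one_mulVec]
  abel

lemma mem_kernelStates (sys : LTISystem n m κ) (z : ℝ) (x : Fin n → ℝ) :
    x ∈ sys.kernelStates z ↔ ∃ w : Fin m → ℝ,
      sys.A *ᵥ x + sys.B *ᵥ w = z • x ∧ sys.C *ᵥ x + sys.D *ᵥ w = 0 := by
  have hker : ∀ y w, sys.rosenbrock ℝ z *ᵥ Sum.elim y w = 0 ↔
      sys.A *ᵥ y + sys.B *ᵥ w = z • y ∧ sys.C *ᵥ y + sys.D *ᵥ w = 0 := by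
    intro y w
    rw [mulVec_rosenbrock, ← sub_eq_zero (b := z • y), ← Sum.elim_zero_zero, Sum.elim_eq_iff]
  rw [kernelStates, Submodule.mem_map]
  constructor
  · rintro ⟨u, hu, rfl⟩
    refine ⟨u ∘ Sum.inr, (hker _ _).1 ?_⟩
    have : Sum.elim (LinearMap.funLeft ℝ ℝ (Sum.inl : Fin n → Fin n ⊕ Fin m) u) (u ∘ Sum.inr) = u :=
      Sum.elim_comp_inl_inr u
    rw [this]
    exact hu
  · rintro ⟨w, hw⟩
    exact ⟨Sum.elim x w, (hker _ _).2 hw, rfl⟩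

lemma mem_Rj (sys : LTISystem n m κ) (j : κ) (z : ℝ) (x : Fin n → ℝ) :
    x ∈ sys.Rj j z ↔ ∃ w : Fin m → ℝ,
      sys.A *ᵥ x + sys.B *ᵥ w = z • x ∧ ∀ k ≠ j, (sys.C *ᵥ x + sys.D *ᵥ w) k = 0 := by
  rw [Rj, mem_kernelStates]
  refine exists_congr fun w => and_congr Iff.rfl ?_
  rw [funext_iff, Subtype.forall]
  exact Iff.rfl

end Rosenbrock

end LTISystem

/-! ### The two implications -/

section

open Polynomial

namespace LTISystem

variable {n m p : ℕ}

lemma stableRegion_of_mem_errorModes {T : TimeDomain} {a : ℝ} (ha : a ∈ T.errorModes) :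
    (a : ℂ) ∈ T.stableRegion := by
  cases T
  · simpa [TimeDomain.errorModes, TimeDomain.stableRegion] using ha
  · have h : 0 < a ∧ a < 1 := ha
    simp only [TimeDomain.stableRegion, Set.mem_ofPred_eq, Complex.norm_real, Real.norm_eq_abs]
    rw [abs_of_pos h.1]
    exact h.2

/-- For a solving feedback, the kernel of `C + DF` is `𝒱*_g` when the latter has codimension
`p`. -/
lemma ker_output_eq_Vg (sys : LTISystem n m (Fin p)) (T : TimeDomain)
    (hdim : (Module.finrank ℝ (sys.Vg T) : ℤ) = (n : ℤ) - (p : ℤ)) {lam : Fin p → ℝ}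
    {F : Matrix (Fin m) (Fin n) ℝ} (hF : sys.IsStabilising T F)
    (hrow : ∀ x k, ((sys.C + sys.D * F) *ᵥ sys.closedLoop F x) k =
        lam k * ((sys.C + sys.D * F) *ᵥ x) k) :
    LinearMap.ker (sys.C + sys.D * F).mulVecLin = sys.Vg T := by
  apply Submodule.eq_of_le_of_finrank_le
  · apply le_sSup
    obtain ⟨q, hq0, hqΩ, hq⟩ := (isStabilising_iff sys T F).1 hF
    refine (isStabOutputNulling_iff sys T _).2 ⟨F, fun v hv => ?_, fun v hv => ?_, q, hq0, hqΩ,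
      fun v _ => by rw [hq]; rfl⟩
    · have hv' : (sys.C + sys.D * F) *ᵥ v = 0 := hv
      change (sys.C + sys.D * F) *ᵥ _ = 0
      ext k
      rw [hrow, hv']
      simp
    · rw [← closedLoop_output_apply]
      exact hv
  · have h1 := LinearMap.finrank_range_add_finrank_ker (sys.C + sys.D * F).mulVecLin
    have h2 := Submodule.finrank_le (LinearMap.range (sys.C + sys.D * F).mulVecLin)
    simp only [Module.finrank_fintype_fun_eq_card, Fintype.card_fin] at h1 h2
    omega

/-- For a solving feedback, `ℛ*_j(λ_j)` contains a vector whose closed-loop output is the `j`-th unit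
vector. -/
lemma exists_mem_Rj_output_eq_single (sys : LTISystem n m (Fin p)) (T : TimeDomain)
    (hright : sys.RightInvertible)
    (hdim : (Module.finrank ℝ (sys.Vg T) : ℤ) = (n : ℤ) - (p : ℤ)) {lam : Fin p → ℝ}
    (hlam : ∀ j, lam j ∈ T.errorModes) (hlamZ : ∀ j, (lam j : ℂ) ∉ sys.invariantZeros)
    {F : Matrix (Fin m) (Fin n) ℝ} (hF : sys.IsStabilising T F)
    (hrow : ∀ x k, ((sys.C + sys.D * F) *ᵥ sys.closedLoop F x) k =
        lam k * ((sys.C + sys.D * F) *ᵥ x) k) (j : Fin p) :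
    ∃ x ∈ sys.Rj j (lam j), (sys.C + sys.D * F) *ᵥ x = Pi.single j 1 := by
  have hker := ker_output_eq_Vg sys T hdim hF hrow
  have hmem : ∀ x, x ∈ sys.Vg T ↔ (sys.C + sys.D * F) *ᵥ x = 0 := by
    intro x
    rw [← hker]
    rfl
  have hsurj : LinearMap.range (sys.C + sys.D * F).mulVecLin = ⊤ := by
    apply Submodule.eq_top_of_finrank_eq
    have h1 := LinearMap.finrank_range_add_finrank_ker (sys.C + sys.D * F).mulVecLin
    rw [hker] at h1
    simp only [Module.finrank_fintype_fun_eq_card, Fintype.card_fin] at h1 ⊢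
    omega
  obtain ⟨x₀, hx₀⟩ : (Pi.single j 1 : Fin p → ℝ) ∈
      LinearMap.range (sys.C + sys.D * F).mulVecLin := hsurj ▸ Submodule.mem_top
  replace hx₀ : (sys.C + sys.D * F) *ᵥ x₀ = Pi.single j 1 := hx₀
  -- Row `j` contributes `lam j - lam j`, and every other row vanishes at `x₀`.
  have hκ : sys.closedLoop F x₀ - lam j • x₀ ∈ sys.Vg T := by
    rw [hmem]
    ext k
    rw [Matrix.mulVec_sub, Matrix.mulVec_smul, Pi.sub_apply, Pi.smul_apply, hrow, hx₀]
    by_cases hkj : k = j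
    · subst hkj; simp
    · simp [hkj]
  obtain ⟨u, hu⟩ := hright.rosenbrock_surjective sys (hlamZ j)
    (Sum.elim (-(sys.closedLoop F x₀ - lam j • x₀)) 0)
  rw [← Sum.elim_comp_inl_inr u, mulVec_rosenbrock, Sum.elim_eq_iff] at hu
  obtain ⟨hu₁, hu₂⟩ := hu
  set x := u ∘ Sum.inl
  set w := u ∘ Sum.inr
  -- Otherwise the correction `x`, moved with stable factor `lam j` modulo `𝒱*_g` at zero output,
  -- would enlarge `𝒱*_g`.
  have hxV : x ∈ sys.Vg T := by
    by_contra hx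
    have hext := isStabOutputNulling_sup_span_singleton sys T (isStabOutputNulling_Vg sys T) hx
      (w := w) (stableRegion_of_mem_errorModes (hlam j)) (hu₁ ▸ neg_mem hκ) hu₂
    exact hx (le_sSup (a := sys.Vg T ⊔ Submodule.span ℝ {x}) hext
      (Submodule.mem_sup_right (Submodule.mem_span_singleton_self x)))
  refine ⟨x₀ + x, (mem_Rj _ _ _ _).2 ⟨F *ᵥ x₀ + w, ?_, fun k hk => ?_⟩, ?_⟩
  · rw [closedLoop_apply] at hu₁
    rw [← sub_eq_zero]
    have := sub_eq_zero.2 hu₁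
    rw [← this]
    simp only [Matrix.mulVec_add]
    module
  · have h1 : sys.C *ᵥ (x₀ + x) + sys.D *ᵥ (F *ᵥ x₀ + w) =
        (sys.C *ᵥ x₀ + sys.D *ᵥ (F *ᵥ x₀)) + (sys.C *ᵥ x + sys.D *ᵥ w) := by
      simp only [Matrix.mulVec_add]
      abel
    rw [h1, hu₂, ← closedLoop_output_apply, hx₀, add_zero, Pi.single_eq_of_ne hk]
  · rw [Matrix.mulVec_add, (hmem x).1 hxV, hx₀, add_zero]

/-- Rank-nullity for the quotient map restricted to `W`, with kernel `V ⊓ W`. It translates the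
dimension condition into Rado's condition in the quotient. -/
lemma finrank_sup_eq_add_finrank_map_mkQ {K E : Type*} [Field K] [AddCommGroup E] [Module K E]
    [FiniteDimensional K E] (V W : Submodule K E) :
    Module.finrank K ↥(V ⊔ W) = Module.finrank K V + Module.finrank K (W.map V.mkQ) := by
  have h1 := LinearMap.finrank_range_add_finrank_ker (V.mkQ.domRestrict W)
  have h2 := Submodule.finrank_sup_add_finrank_inf_eq V W
  rw [LinearMap.range_domRestrict, LinearMap.ker_domRestrict, Submodule.ker_mkQ] at h1
  have h3 : Module.finrank K (V.comap W.subtype) = Module.finrank K ↥(V ⊓ W) := by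
    rw [← Submodule.finrank_map_subtype_eq, Submodule.map_comap_subtype, inf_comm]
  omega

theorem SingleModeSolvable.le_finrank (sys : LTISystem n m (Fin p)) (T : TimeDomain)
    (hright : sys.RightInvertible)
    (hdim : (Module.finrank ℝ (sys.Vg T) : ℤ) = (n : ℤ) - (p : ℤ)) {lam : Fin p → ℝ}
    (hlam : ∀ j, lam j ∈ T.errorModes) (hlamZ : ∀ j, (lam j : ℂ) ∉ sys.invariantZeros)
    (h : sys.SingleModeSolvable T lam) (S : Finset (Fin p)) :
    (n : ℤ) - (p : ℤ) + (S.card : ℤ) ≤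
          (Module.finrank ℝ ↥(sys.Vg T ⊔ ⨆ j ∈ S, sys.Rj j (lam j)) : ℤ) := by
  obtain ⟨F, hF, htrack⟩ := h
  have hrow := (forall_hasSingleModeError_iff sys T lam F).1 htrack
  have hker := ker_output_eq_Vg sys T hdim hF hrow
  choose x hxR hx using
    exists_mem_Rj_output_eq_single sys T hright hdim hlam hlamZ hF hrow
  rw [finrank_sup_eq_add_finrank_map_mkQ, Nat.cast_add, hdim]
  -- The output map factors through the quotient and sends these classes to distinct unit vectors.
  have hli : LinearIndependent ℝ (fun j : S => (sys.Vg T).mkQ (x j)) := by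
    have hle : sys.Vg T ≤ LinearMap.ker (sys.C + sys.D * F).mulVecLin := hker.ge
    refine LinearIndependent.of_comp ((sys.Vg T).liftQ _ hle) ?_
    have he : (((sys.Vg T).liftQ _ hle) ∘ fun j : S => (sys.Vg T).mkQ (x j)) =
        fun j : S => (Pi.single (j : Fin p) (1 : ℝ) : Fin p → ℝ) := by
      ext1 j
      exact hx j
    rw [he]
    exact (Pi.linearIndependent_single_one (Fin p) ℝ).comp _ Subtype.val_injective
  have hspan : Submodule.span ℝ (Set.range fun j : S => (sys.Vg T).mkQ (x j)) ≤
      (⨆ j ∈ S, sys.Rj j (lam j)).map (sys.Vg T).mkQ := by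
    rw [Submodule.span_le]
    rintro _ ⟨j, rfl⟩
    exact Submodule.mem_map_of_mem
      (Submodule.mem_iSup_of_mem _ (Submodule.mem_iSup_of_mem j.2 (hxR j)))
  have hcard := (finrank_span_eq_card hli).symm.trans_le (Submodule.finrank_mono hspan)
  rw [Fintype.card_coe] at hcard
  omega

theorem singleModeSolvable_of_le_finrank (sys : LTISystem n m (Fin p)) (T : TimeDomain)
    (hdim : (Module.finrank ℝ (sys.Vg T) : ℤ) = (n : ℤ) - (p : ℤ)) {lam : Fin p → ℝ}
    (hlam : ∀ j, lam j ∈ T.errorModes)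
    (h : ∀ S : Finset (Fin p), (n : ℤ) - (p : ℤ) + (S.card : ℤ) ≤
          (Module.finrank ℝ ↥(sys.Vg T ⊔ ⨆ j ∈ S, sys.Rj j (lam j)) : ℤ)) :
    sys.SingleModeSolvable T lam := by
  obtain ⟨F₀, hV₀, hout₀, q, hq0, hqΩ, hq⟩ :=
    (isStabOutputNulling_iff sys T _).1 (isStabOutputNulling_Vg sys T)
  set V := sys.Vg T
  obtain ⟨v', hv'R, hv'⟩ := exists_linearIndependent_transversal
    (fun j => (sys.Rj j (lam j)).map V.mkQ) (fun S => by
      have := h S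
      have hmap : (⨆ j ∈ S, sys.Rj j (lam j)).map V.mkQ =
          ⨆ j ∈ S, (sys.Rj j (lam j)).map V.mkQ := by
        simp only [Submodule.map_iSup]
      rw [finrank_sup_eq_add_finrank_map_mkQ, hmap] at this
      omega)
  choose v hvR hv using hv'R
  obtain rfl : (fun j => V.mkQ (v j)) = v' := funext hv
  choose w hw hwout using fun j => (mem_Rj sys j (lam j) (v j)).1 (hvR j)
  -- Each `v j` becomes a closed-loop eigenvector for `lam j`, and the behaviour on `V` is retained.
  obtain ⟨F, hFV, hFv⟩ := exists_feedback_extension F₀ V v hv' w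
  have hspan : ∀ x, ∃ y ∈ V, ∃ c : Fin p → ℝ, x = y + ∑ j, c j • v j := by
    -- The quotient has dimension exactly `p`, so `p` independent classes span it.
    have htop : Submodule.span ℝ (Set.range fun j => V.mkQ (v j)) = ⊤ := by
      apply hv'.span_eq_top_of_card_eq_finrank'
      have := V.finrank_quotient_add_finrank
      rw [Module.finrank_fintype_fun_eq_card, Fintype.card_fin] at this
      rw [Fintype.card_fin]
      omega
    intro x
    obtain ⟨c, hc⟩ := (Submodule.mem_span_range_iff_exists_fun ℝ).1
      (htop ▸ Submodule.mem_top : V.mkQ x ∈ _)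
    refine ⟨x - ∑ j, c j • v j, ?_, c, by abel⟩
    rw [← V.ker_mkQ, LinearMap.mem_ker, map_sub, map_sum, ← hc]
    simp
  set f := sys.closedLoop F with hf
  have hfV : ∀ y ∈ V, f y = sys.closedLoop F₀ y := fun y hy => by
    rw [hf, closedLoop_apply, closedLoop_apply, hFV y hy]
  have hfv : ∀ j, f (v j) = lam j • v j := fun j => by
    rw [hf, closedLoop_apply, hFv, hw]
  refine ⟨F, ?_, (forall_hasSingleModeError_iff sys T lam F).2 fun x k => ?_⟩
  · have hprod0 : ∏ j, (X - Polynomial.C (lam j)) ≠ 0 :=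
      Finset.prod_ne_zero_iff.2 fun j _ => X_sub_C_ne_zero _
    have hprodΩ : (∏ j, (X - Polynomial.C (lam j))).rootSet ℂ ⊆ T.stableRegion := by
      intro z hz
      have := (mem_rootSet.1 hz).2
      rw [map_prod, Finset.prod_eq_zero_iff] at this
      obtain ⟨j, -, hj⟩ := this
      exact rootSet_X_sub_C_subset (stableRegion_of_mem_errorModes (hlam j))
        (mem_rootSet.2 ⟨X_sub_C_ne_zero _, hj⟩)
    rw [isStabilising_iff]
    -- The product kills every `v j` and preserves `V`, so it maps the whole space into `V`, which
    -- `q` annihilates.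
    refine ⟨q * ∏ j, (X - Polynomial.C (lam j)), mul_ne_zero hq0 hprod0,
      rootSet_mul_subset hqΩ hprodΩ (mul_ne_zero hq0 hprod0), LinearMap.ext fun x => ?_⟩
    obtain ⟨y, hy, c, rfl⟩ := hspan x
    have hz : ∀ j, aeval f (∏ j, (X - Polynomial.C (lam j))) (v j) = 0 := fun j => by
      rw [← Finset.prod_erase_mul _ _ (Finset.mem_univ j), map_mul, Module.End.mul_apply]
      have : aeval f (X - Polynomial.C (lam j)) (v j) = 0 := by
        simp [hfv, Module.algebraMap_end_apply]
      rw [this, map_zero]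
    have hqV : ∀ y ∈ V, aeval f q y = 0 := fun y hy => by
      rw [aeval_apply_congr _ f V hV₀ hfV q hy, hq y hy]
    rw [← hf, map_mul, Module.End.mul_apply, map_add, map_sum]
    simp only [map_smul, hz, smul_zero, Finset.sum_const_zero, add_zero]
    exact hqV _ (aeval_apply_mem f V (fun y hy => hfV y hy ▸ hV₀ y hy) _ hy)
  · have hVout : ∀ y ∈ V, (sys.C + sys.D * F) *ᵥ y = 0 := fun y hy => by
      rw [closedLoop_output_apply, hFV y hy, hout₀ y hy]
    have hvout : ∀ j, k ≠ j → ((sys.C + sys.D * F) *ᵥ v j) k = 0 := fun j hj => by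
      rw [closedLoop_output_apply, hFv]
      exact hwout j k hj
    let φ : (Fin n → ℝ) →ₗ[ℝ] ℝ := LinearMap.proj k ∘ₗ (sys.C + sys.D * F).mulVecLin
    change φ (f x) = lam k * φ x
    have hφV : ∀ y ∈ V, φ y = 0 := fun y hy => by
      change ((sys.C + sys.D * F) *ᵥ y) k = 0
      rw [hVout y hy]
      rfl
    obtain ⟨y, hy, c, rfl⟩ := hspan x
    simp only [map_add, map_sum, map_smul, hfv, hφV y hy, hφV (f y) (hfV y hy ▸ hV₀ y hy),
      zero_add, smul_eq_mul, Finset.mul_sum]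
    refine Finset.sum_congr rfl fun j _ => ?_
    by_cases hkj : k = j
    · subst hkj
      ring
    · have : φ (v j) = 0 := hvout j hkj
      rw [this]
      ring

end LTISystem

end

theorem theorem1 {n m p : ℕ} (sys : LTISystem n m (Fin p)) (T : TimeDomain)
    (hcol : LinearIndependent ℝ (Matrix.fromRows sys.B sys.D).col)
    (hrow : LinearIndependent ℝ (Matrix.fromCols sys.C sys.D).row)
    (hright : sys.RightInvertible)
    (hstab : sys.Stabilisable T)
    (hzero : (T.steadyFreq : ℂ) ∉ sys.invariantZeros)
    (hdim : (Module.finrank ℝ (sys.Vg T) : ℤ) = (n : ℤ) - (p : ℤ))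
    (lam : Fin p → ℝ)
    (hlam : ∀ j, lam j ∈ T.errorModes)
    (hlamZ : ∀ j, (lam j : ℂ) ∉ sys.invariantZeros) :
    sys.SingleModeSolvable T lam ↔
      ∀ S : Finset (Fin p),
        (n : ℤ) - (p : ℤ) + (S.card : ℤ) ≤
          (Module.finrank ℝ ↥(sys.Vg T ⊔ ⨆ j ∈ S, sys.Rj j (lam j)) : ℤ) := by
  exact ⟨fun h S => h.le_finrank sys T hright hdim hlam hlamZ S,
    LTISystem.singleModeSolvable_of_le_finrank sys T hdim hlam⟩
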